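/- Let $D\subset\mathbb{R}^n$ be a closed disc (a subset homeomorphic to the closed unit ball of $\mathbb{R}^n$, for instance a closed round ball of positive radius). Let $g_1,g_2\colon D\to D$ be injective continuous maps such that $g_1(D)\cap g_2(D)=\varnothing$, and let $\Sigma\subset D$ be a finite subset. Then there is $M\in\mathbb{N}$ such that for every $m\ge M$ there exists a periodic orbit of length $m$, $$p_0,\,p_1,\,\ldots,\,p_m=p_0,\qquad p_{i+1}\in\{g_1(p_i),\,g_2(p_i)\}\quad\text{for } 0\le i<m,$$ with all $p_i\in D$ (the points $p_0,\ldots,p_{m-1}$ need not be distinct), that never meets $\Sigma$, i.e. $p_i\notin\Sigma$ for all $i$. -/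

import Mathlib

/-- `D ⊆ ℝⁿ` is a closed (`n`-dimensional) disc: with the topology induced from `ℝⁿ` it is
homeomorphic to the closed unit ball of `ℝⁿ`. Round closed balls of positive radius are the basic
example, see `IsClosedDisc.closedBall`. -/
def IsClosedDisc {n : ℕ} (D : Set (EuclideanSpace ℝ (Fin n))) : Prop :=
  Nonempty (D ≃ₜ Metric.closedBall (0 : EuclideanSpace ℝ (Fin n)) 1)

/-- Every round closed ball of positive radius is a closed disc. -/
theorem IsClosedDisc.closedBall {n : ℕ} (c : EuclideanSpace ℝ (Fin n)) {r : ℝ} (hr : 0 < r) :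
    IsClosedDisc (Metric.closedBall c r) := by
  let h : EuclideanSpace ℝ (Fin n) ≃ₜ EuclideanSpace ℝ (Fin n) :=
    (Homeomorph.smulOfNeZero r hr.ne').trans (Homeomorph.addLeft c)
  have him : h '' Metric.closedBall 0 1 = Metric.closedBall c r := by
    rw [← affinity_unitClosedBall hr.le c, ← Set.image_smul, ← Set.image_vadd, Set.image_image]
    rfl
  exact ⟨((h.image _).trans (Homeomorph.setCongr him)).symm⟩

/-- A periodic orbit `p₀, p₁, …, pₘ = p₀` of length `m` each of whose points is obtained from the
previous one by applying `g₁` or `g₂`. The points need not be distinct. -/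
structure IsPeriodicOrbit {X : Type*} (g₁ g₂ : X → X) (m : ℕ) (p : Fin (m + 1) → X) : Prop where
  closed : p (Fin.last m) = p 0
  step : ∀ i : Fin m, p i.succ = g₁ (p i.castSucc) ∨ p i.succ = g₂ (p i.castSucc)

/-! Each word of length `m` in the two maps composes to a continuous self-map of the disc, so
Brouwer gives it a fixed point and hence a periodic orbit. Injectivity and disjoint ranges make
backward itineraries unique: if the orbit is in `S` at time `i`, the pair of `i` and that point
determines the whole word. At most `m * |S|` words can thus give orbits meeting `S`, fewer than `2 ^
m` for large `m`.

Brouwer follows from the absence of a `C¹` retraction `r` onto the sphere, by a volume argument.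
With `h = r - id`, the map `id + t h` is for small `t > 0` a bijection of the open ball with
positive Jacobian, so its Jacobian integrates to the volume. The integral is polynomial in `t`, so
the same holds at `t = 1`, where the Jacobian of `r` vanishes. -/

open Metric Set Filter Topology MeasureTheory

/-! ### Determinants of perturbations of the identity -/

theorem exists_forall_pos_det_one_add (E : Type*) [NormedAddCommGroup E] [NormedSpace ℝ E]
    [FiniteDimensional ℝ E] :
    ∃ δ > 0, ∀ A : E →L[ℝ] E, ‖A‖ < δ → 0 < (1 + A).det := by
  have hc : Continuous fun A : E →L[ℝ] E => (1 + A).det :=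
    ContinuousLinearMap.continuous_det.comp (continuous_const.add continuous_id)
  have h0 : ∀ᶠ A : E →L[ℝ] E in 𝓝 0, 0 < (1 + A).det := by
    refine hc.continuousAt.eventually (lt_mem_nhds ?_)
    simp [ContinuousLinearMap.det]
  obtain ⟨δ, hδ, h⟩ := Metric.eventually_nhds_iff.1 h0
  exact ⟨δ, hδ, fun A hA => h (by simpa using hA)⟩

/-- The degree bound is uniform in `A`, so one set of interpolation nodes serves every `A`. -/
theorem exists_polynomial_eval_eq_det_one_add_smul {E : Type*} [NormedAddCommGroup E]
    [NormedSpace ℝ E] [FiniteDimensional ℝ E] (A : E →L[ℝ] E) :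
    ∃ p : Polynomial ℝ, p.natDegree ≤ Module.finrank ℝ E ∧
      ∀ t : ℝ, p.eval t = (1 + t • A).det := by
  let b := Module.finBasis ℝ E
  let M := LinearMap.toMatrix b b (A : E →ₗ[ℝ] E)
  refine ⟨((Polynomial.X : Polynomial ℝ) • M.map Polynomial.C +
    (1 : Matrix _ _ ℝ).map Polynomial.C).det, ?_, fun t => ?_⟩
  · simpa using Polynomial.natDegree_det_X_add_C_le M 1
  · rw [← Polynomial.coe_evalRingHom, RingHom.map_det, ContinuousLinearMap.det,
      ← LinearMap.det_toMatrix b]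
    have : ((1 + t • A : E →L[ℝ] E) : E →ₗ[ℝ] E) = LinearMap.id + t • (A : E →ₗ[ℝ] E) := rfl
    rw [this, map_add (LinearMap.toMatrix b b), map_smul (LinearMap.toMatrix b b),
      LinearMap.toMatrix_id]
    congr 1
    ext i j
    rcases eq_or_ne i j with rfl | hij
    · simp [M, add_comm, mul_comm t]
    · simp [M, hij, mul_comm t]

/-- The values of `t ↦ det (1 + t A)` at arbitrarily small `t` determine its value at `1`, with
coefficients that do not depend on `A`. -/
theorem exists_det_one_add_eq_sum (E : Type*) [NormedAddCommGroup E] [NormedSpace ℝ E]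
    [FiniteDimensional ℝ E] {ε : ℝ} (hε : 0 < ε) :
    ∃ (s : Finset ℕ) (t c : ℕ → ℝ), (∀ i ∈ s, 0 < t i ∧ t i ≤ ε) ∧ ∑ i ∈ s, c i = 1 ∧
      ∀ A : E →L[ℝ] E, (1 + A).det = ∑ i ∈ s, c i * (1 + t i • A).det := by
  let t : ℕ → ℝ := fun i => ε / (i + 1)
  let s := Finset.range (Module.finrank ℝ E + 1)
  have ht : Set.InjOn t s := by
    intro i _ j _ hij
    have h1 : (i : ℝ) + 1 ≠ 0 := by positivity
    have h2 : (j : ℝ) + 1 ≠ 0 := by positivity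
    simp only [t] at hij
    rw [div_eq_div_iff h1 h2] at hij
    have := mul_left_cancel₀ hε.ne' hij
    exact_mod_cast (add_right_cancel this).symm
  -- The weights are the Lagrange basis polynomials at `1`; they sum to `1` because the basis sums
  -- to the constant polynomial `1`.
  refine ⟨s, t, fun i => (Lagrange.basis s t i).eval 1, fun i _ => ⟨by positivity, ?_⟩, ?_, ?_⟩
  · exact div_le_self hε.le (by simp)
  · rw [← Polynomial.eval_finsetSum, Lagrange.sum_basis ht ⟨0, by simp [s]⟩, Polynomial.eval_one]
  · intro A
    obtain ⟨p, hp, hpt⟩ := exists_polynomial_eval_eq_det_one_add_smul A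
    have hdeg : p.degree < s.card := by
      refine lt_of_le_of_lt Polynomial.degree_le_natDegree ?_
      simp only [s, Finset.card_range]
      exact_mod_cast Nat.lt_succ_of_le hp
    have h1 := congrArg (Polynomial.eval 1) (Lagrange.eq_interpolate ht hdeg)
    rw [Lagrange.interpolate_apply, Polynomial.eval_finsetSum, hpt, one_smul] at h1
    rw [h1]
    refine Finset.sum_congr rfl fun i _ => ?_
    rw [Polynomial.eval_mul, Polynomial.eval_C, hpt, mul_comm]

/-! ### No `C¹` retraction onto the sphere -/

/-- A small Lipschitz perturbation of the identity that maps the closed unit ball to itself and the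
unit sphere to itself maps the open unit ball onto itself. -/
theorem image_ball_eq_of_lipschitz_perturbation {E : Type*} [NormedAddCommGroup E]
    [NormedSpace ℝ E] [Nontrivial E] [FiniteDimensional ℝ E] {f : E → E} {c : NNReal} (hc : c < 1)
    (hf : ApproximatesLinearOn f (ContinuousLinearEquiv.refl ℝ E : E →L[ℝ] E) (closedBall 0 1) c)
    (hmaps : MapsTo f (closedBall 0 1) (closedBall 0 1))
    (hsphere : MapsTo f (sphere 0 1) (sphere 0 1)) :
    f '' ball 0 1 = ball 0 1 := by
  have hopen : IsOpen (f '' ball 0 1) := by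
    refine (hf.mono_set ball_subset_closedBall).open_image
      (ContinuousLinearEquiv.refl ℝ E).toNonlinearRightInverse isOpen_ball (Or.inr ?_)
    have : ((ContinuousLinearEquiv.refl ℝ E).toNonlinearRightInverse.nnnorm : ℝ) = 1 := by
      change ‖ContinuousLinearMap.id ℝ E‖ = 1
      exact ContinuousLinearMap.norm_id
    rw [← NNReal.coe_lt_coe, NNReal.coe_inv, this]
    simpa using hc
  have hcompact : IsCompact (f '' closedBall 0 1) :=
    (isCompact_closedBall _ _).image_of_continuousOn hf.continuousOn
  have hsub : f '' ball 0 1 ⊆ ball 0 1 := by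
    have := interior_maximal ((image_mono ball_subset_closedBall).trans hmaps.image_subset) hopen
    rwa [interior_closedBall _ one_ne_zero] at this
  refine hsub.antisymm ?_
  -- The image is open, and also closed relative to the ball: a limit point is the image of a point
  -- of the closed ball, and sphere points stay on the sphere.
  refine (convex_ball (0 : E) 1).isPreconnected.subset_of_closure_inter_subset hopen
    ⟨f 0, hsub ⟨0, by simp, rfl⟩, 0, by simp, rfl⟩ ?_
  rintro y ⟨hy, hy1⟩
  obtain ⟨x, hx, rfl⟩ : y ∈ f '' closedBall 0 1 :=
    closure_minimal (image_mono ball_subset_closedBall) hcompact.isClosed hy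
  refine ⟨x, ?_, rfl⟩
  by_contra hxb
  have hxs : x ∈ sphere (0 : E) 1 := by
    simp only [mem_closedBall, mem_ball, mem_sphere, not_lt] at *
    exact le_antisymm hx hxb
  exact (mem_ball.1 hy1).ne (mem_sphere.1 (hsphere hxs))

theorem ContDiffAt.exists_lipschitzOnWith_of_isCompact_convex {E F : Type*} [NormedAddCommGroup E]
    [NormedSpace ℝ E] [NormedAddCommGroup F] [NormedSpace ℝ F] {h : E → F} {s : Set E}
    (hs : IsCompact s) (hconv : Convex ℝ s) (hh : ∀ x ∈ s, ContDiffAt ℝ 1 h x) :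
    ∃ K : NNReal, (∀ x ∈ s, ‖fderiv ℝ h x‖ ≤ K) ∧ LipschitzOnWith K h s := by
  have hcont : ContinuousOn (fderiv ℝ h) s := fun x hx =>
    ((hh x hx).fderiv_right (m := 0) (by simp)).continuousAt.continuousWithinAt
  obtain ⟨K, hK⟩ := hs.exists_bound_of_continuousOn hcont
  have hK' : ∀ x ∈ s, ‖fderiv ℝ h x‖ ≤ K.toNNReal := fun x hx =>
    (hK x hx).trans (Real.le_coe_toNNReal K)
  exact ⟨K.toNNReal, hK', hconv.lipschitzOnWith_of_nnnorm_fderiv_le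
    (fun x hx => (hh x hx).differentiableAt (by simp)) fun x hx => hK' x hx⟩

/-- Differentiating `‖r‖ ^ 2 = 1` shows that the range of the derivative is orthogonal to the
nonzero vector `r x`. -/
theorem fderiv_det_eq_zero_of_norm_eq_one {E : Type*} [NormedAddCommGroup E]
    [InnerProductSpace ℝ E] [FiniteDimensional ℝ E] {r : E → E} {x : E}
    (hr : DifferentiableAt ℝ r x) (h1 : ∀ᶠ y in 𝓝 x, ‖r y‖ = 1) : (fderiv ℝ r x).det = 0 := by
  by_contra hdet
  have hd : HasFDerivAt (fun y => ‖r y‖ ^ 2) (2 • (innerSL ℝ (r x)).comp (fderiv ℝ r x)) x :=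
    hr.hasFDerivAt.norm_sq
  have hz : HasFDerivAt (fun y => ‖r y‖ ^ 2) (0 : E →L[ℝ] ℝ) x :=
    (hasFDerivAt_const (1 : ℝ) x).congr_of_eventuallyEq
      (h1.mono fun y hy => by simp [hy])
  have hsurj : Function.Surjective (fderiv ℝ r x) := by
    have hu : IsUnit (fderiv ℝ r x : E →ₗ[ℝ] E) :=
      (LinearMap.isUnit_iff_isUnit_det _).2 (isUnit_iff_ne_zero.2 hdet)
    exact ((Module.End.isUnit_iff _).1 hu).2
  obtain ⟨v, hv⟩ := hsurj (r x)
  have h2 := congrArg (fun L : E →L[ℝ] ℝ => L v) (hd.unique hz)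
  simp [hv, h1.self_of_nhds] at h2

/-- There is no `C¹` retraction of the closed unit ball onto the unit sphere. -/
theorem not_exists_contDiffAt_retraction {E : Type*} [NormedAddCommGroup E]
    [InnerProductSpace ℝ E] [FiniteDimensional ℝ E] {r : E → E}
    (hr : ∀ x ∈ closedBall (0 : E) 1, ContDiffAt ℝ 1 r x)
    (hnorm : ∀ x ∈ closedBall (0 : E) 1, ‖r x‖ = 1)
    (hsphere : ∀ x ∈ sphere (0 : E) 1, r x = x) : False := by
  borelize E
  have : Nontrivial E := ⟨r 0, 0, norm_ne_zero_iff.1 (by simp [hnorm 0 (by simp)])⟩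
  set h : E → E := fun x => r x - x with hh
  have hhC : ∀ x ∈ closedBall (0 : E) 1, ContDiffAt ℝ 1 h x := fun x hx =>
    (hr x hx).sub contDiffAt_id
  obtain ⟨K, hK, hLip⟩ := ContDiffAt.exists_lipschitzOnWith_of_isCompact_convex
    (isCompact_closedBall (0 : E) 1) (convex_closedBall 0 1) hhC
  obtain ⟨δ, hδ, hdet⟩ := exists_forall_pos_det_one_add E
  -- For `t ≤ ε`, `t * K < 1` gives injectivity and surjectivity, `t * K < δ` a positive Jacobian,
  -- and `t ≤ 1` a convex combination of `x` and `r x`.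
  let ε : ℝ := min 1 δ / (2 * (K + 1))
  have hε : 0 < ε := by positivity
  have hεK : ∀ t, 0 < t → t ≤ ε → t * K < 1 ∧ t * K < δ ∧ t ≤ 1 := by
    intro t ht htε
    have hK0 : (0 : ℝ) ≤ K := K.2
    have h1 : t * (2 * (K + 1)) ≤ min 1 δ := by
      rwa [le_div_iff₀ (by positivity)] at htε
    have h2 := h1.trans (min_le_left _ _)
    have h3 := h1.trans (min_le_right _ _)
    have h4 : 0 ≤ t * K := by positivity
    refine ⟨by nlinarith, by nlinarith, by nlinarith⟩
  have hvol : ∀ t, 0 < t → t ≤ ε →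
      ∫ x in ball (0 : E) 1, (1 + t • fderiv ℝ h x).det = volume.real (ball (0 : E) 1) := by
    intro t ht htε
    obtain ⟨h1, h2, h3⟩ := hεK t ht htε
    let f : E → E := fun x => x + t • h x
    have happ : ApproximatesLinearOn f (ContinuousLinearEquiv.refl ℝ E : E →L[ℝ] E)
        (closedBall 0 1) (t.toNNReal * K) := by
      rw [ApproximatesLinearOn.approximatesLinearOn_iff_lipschitzOnWith]
      refine LipschitzOnWith.of_dist_le_mul fun x hx y hy => ?_
      have := hLip.dist_le_mul x hx y hy
      simp only [f, Pi.sub_apply, ContinuousLinearEquiv.coe_refl, ContinuousLinearMap.coe_id',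
        id_eq, add_sub_cancel_left, NNReal.coe_mul, Real.coe_toNNReal t ht.le]
      rw [dist_smul₀, Real.norm_of_nonneg ht.le, mul_assoc]
      gcongr
    have hc : t.toNNReal * K < 1 := by
      rw [← NNReal.coe_lt_coe]
      simpa [Real.coe_toNNReal t ht.le] using h1
    have hmaps : MapsTo f (closedBall 0 1) (closedBall 0 1) := by
      intro x hx
      have hrx : r x ∈ closedBall (0 : E) 1 := by simp [hnorm x hx]
      have : f x = (1 - t) • x + t • r x := by simp only [f, hh]; module
      rw [this]
      exact convex_closedBall (0 : E) 1 hx hrx (by linarith) ht.le (by ring)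
    have hsph : MapsTo f (sphere 0 1) (sphere 0 1) := by
      intro x hx
      simpa [f, hh, hsphere x hx] using hx
    have himage := image_ball_eq_of_lipschitz_perturbation hc happ hmaps hsph
    have hinj : InjOn f (ball 0 1) := by
      intro x hx y hy hxy
      have h5 := hLip.dist_le_mul x (ball_subset_closedBall hx) y (ball_subset_closedBall hy)
      have h6 : x - y = t • (h y - h x) := by
        simp only [f] at hxy
        rw [smul_sub, sub_eq_sub_iff_add_eq_add, hxy, add_comm]
      have h7 : dist x y ≤ t * K * dist x y := by
        calc dist x y = t * dist (h x) (h y) := by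
              rw [dist_eq_norm x y, h6, norm_smul, Real.norm_of_nonneg ht.le, dist_comm,
                dist_eq_norm]
          _ ≤ t * K * dist x y := by
              rw [mul_assoc]
              gcongr
      by_contra hne
      have := dist_pos.2 hne
      nlinarith
    have hder : ∀ x ∈ ball (0 : E) 1,
        HasFDerivWithinAt f (1 + t • fderiv ℝ h x) (ball 0 1) x := by
      intro x hx
      have := ((hhC x (ball_subset_closedBall hx)).differentiableAt (by simp)).hasFDerivAt
      exact ((hasFDerivAt_id x).add (this.const_smul t)).hasFDerivWithinAt
    have key := integral_image_eq_integral_abs_det_fderiv_smul volume measurableSet_ball hder hinj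
      (fun _ => (1 : ℝ))
    rw [himage] at key
    simp only [setIntegral_const, smul_eq_mul, mul_one] at key
    rw [key]
    refine setIntegral_congr_fun measurableSet_ball fun x hx => ?_
    refine (abs_of_pos (hdet _ ?_)).symm
    rw [norm_smul, Real.norm_of_nonneg ht.le]
    refine lt_of_le_of_lt ?_ h2
    gcongr
    exact hK x (ball_subset_closedBall hx)
  obtain ⟨s, t, c, ht, hc1, hsum⟩ := exists_det_one_add_eq_sum E hε
  have hint : ∀ τ : ℝ, IntegrableOn (fun x => (1 + τ • fderiv ℝ h x).det) (ball (0 : E) 1) := by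
    intro τ
    refine (ContinuousOn.integrableOn_compact (isCompact_closedBall 0 1) ?_).mono_set
      ball_subset_closedBall
    have hcont : ContinuousOn (fderiv ℝ h) (closedBall 0 1) := fun x hx =>
      ((hhC x hx).fderiv_right (m := 0) (by simp)).continuousAt.continuousWithinAt
    exact ContinuousLinearMap.continuous_det.comp_continuousOn
      (continuousOn_const.add (hcont.const_smul τ))
  have h0 : ∫ x in ball (0 : E) 1, (1 + fderiv ℝ h x).det = 0 := by
    refine (setIntegral_congr_fun measurableSet_ball fun x hx => ?_).trans (integral_zero _ _)
    have hd := (hr x (ball_subset_closedBall hx)).differentiableAt (by simp)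
    have hfd : 1 + fderiv ℝ h x = fderiv ℝ r x := by
      rw [hh, fderiv_fun_sub hd differentiableAt_fun_id, fderiv_fun_id]
      exact add_sub_cancel _ _
    rw [hfd]
    refine fderiv_det_eq_zero_of_norm_eq_one hd ?_
    filter_upwards [isOpen_ball.mem_nhds hx] with y hy using hnorm y (ball_subset_closedBall hy)
  have hpos : 0 < volume.real (ball (0 : E) 1) :=
    ENNReal.toReal_pos (measure_ball_pos _ _ one_pos).ne' measure_ball_lt_top.ne
  -- Interpolation is applied pointwise; its weights do not depend on `x`, so they come out of the
  -- integral.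
  have h1 : ∫ x in ball (0 : E) 1, (1 + fderiv ℝ h x).det = volume.real (ball (0 : E) 1) := by
    rw [setIntegral_congr_fun measurableSet_ball fun x _ => hsum (fderiv ℝ h x),
      integral_finsetSum _ fun i _ => (hint (t i)).const_mul (c i)]
    simp_rw [integral_const_mul]
    rw [Finset.sum_congr rfl fun i hi => by rw [hvol (t i) (ht i hi).1 (ht i hi).2],
      ← Finset.sum_mul, hc1, one_mul]
  linarith
-- Brouwer's fixed point theorem
/-- A smooth map from a Euclidean space into its closed unit ball has a fixed point. -/
theorem exists_fixedPoint_of_contDiff_of_norm_le_one {E : Type*} [NormedAddCommGroup E]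
    [InnerProductSpace ℝ E] [FiniteDimensional ℝ E] {f : E → E} (hf : ContDiff ℝ 1 f)
    (h1 : ∀ x, ‖f x‖ ≤ 1) : ∃ x, f x = x := by
  by_contra! hne
  let u : E → E := fun x => x - f x
  have hu : ContDiff ℝ 1 u := contDiff_id.sub hf
  have hu0 : ∀ x, 0 < ‖u x‖ ^ 2 := fun x => by
    have : u x ≠ 0 := sub_ne_zero.2 (hne x).symm
    positivity
  -- A quarter of the discriminant of `‖x + l • u x‖ ^ 2 = 1`, a quadratic in `l`. Its larger root
  -- takes `x` to where the ray from `f x` through `x` leaves the ball.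
  let d : E → ℝ := fun x => inner ℝ x (u x) ^ 2 + ‖u x‖ ^ 2 * (1 - ‖x‖ ^ 2)
  have hdC : ContDiff ℝ 1 d :=
    ((ContDiff.inner ℝ contDiff_id hu).pow 2).add
      ((hu.norm_sq ℝ).mul (contDiff_const.sub (contDiff_id.norm_sq ℝ)))
  -- On the sphere, `2⟪x, u x⟫ = ‖u x‖ ^ 2 + 1 - ‖f x‖ ^ 2`. The sign makes the larger root zero
  -- there.
  have hin : ∀ x ∈ sphere (0 : E) 1, 0 < inner ℝ x (u x) := by
    intro x hx
    have hx1 : ‖x‖ = 1 := by simpa using hx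
    have h2 : ‖u x‖ ^ 2 = ‖x‖ ^ 2 - 2 * inner ℝ x (f x) + ‖f x‖ ^ 2 := norm_sub_sq_real x (f x)
    have h3 : inner ℝ x (u x) = ‖x‖ ^ 2 - inner ℝ x (f x) := by
      rw [inner_sub_right, real_inner_self_eq_norm_sq]
    have h4 := hu0 x
    have h5 : ‖f x‖ ^ 2 ≤ 1 := pow_le_one₀ (norm_nonneg _) (h1 x)
    rw [hx1] at h2 h3
    linarith
  have hd0 : ∀ x ∈ closedBall (0 : E) 1, 0 < d x := by
    intro x hx
    have hx1 : ‖x‖ ≤ 1 := by simpa using hx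
    rcases hx1.lt_or_eq with hlt | heq
    · have : 0 < 1 - ‖x‖ ^ 2 := by nlinarith [norm_nonneg x]
      have := mul_pos (hu0 x) this
      positivity
    · have := hin x (by simpa using heq)
      simp only [d, heq]
      nlinarith
  let l : E → ℝ := fun x => (√(d x) - inner ℝ x (u x)) / ‖u x‖ ^ 2
  have hlC : ∀ x ∈ closedBall (0 : E) 1, ContDiffAt ℝ 1 l x := fun x hx =>
    ((hdC.contDiffAt.sqrt (hd0 x hx).ne').sub (ContDiff.inner ℝ contDiff_id hu).contDiffAt).div
      (hu.norm_sq ℝ).contDiffAt (hu0 x).ne'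
  refine not_exists_contDiffAt_retraction (r := fun x => x + l x • u x)
    (fun x hx => contDiffAt_id.add ((hlC x hx).smul hu.contDiffAt)) (fun x hx => ?_)
    fun x hx => ?_
  · have hs := Real.sq_sqrt (hd0 x hx).le
    have hl : l x * ‖u x‖ ^ 2 = √(d x) - inner ℝ x (u x) := div_mul_cancel₀ _ (hu0 x).ne'
    have key : ‖x + l x • u x‖ ^ 2 = 1 := by
      rw [norm_add_sq_real, norm_smul, inner_smul_right, mul_pow, Real.norm_eq_abs, sq_abs]
      refine mul_left_cancel₀ (hu0 x).ne' ?_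
      have : (l x * ‖u x‖ ^ 2 + inner ℝ x (u x)) ^ 2 = d x := by rw [hl, sub_add_cancel, hs]
      simp only [d] at this
      linear_combination this
    exact (pow_eq_one_iff_of_nonneg (norm_nonneg _) two_ne_zero).1 key
  · have hx1 : ‖x‖ = 1 := by simpa using hx
    have : l x = 0 := by
      simp only [l, d, hx1]
      rw [one_pow, sub_self, mul_zero, add_zero, Real.sqrt_sq (hin x hx).le, sub_self, zero_div]
    simp [this]

/-- A continuous map into the closed unit ball is uniformly approximated by smooth maps into the
closed unit ball. -/
theorem Continuous.exists_contDiff_dist_lt_of_norm_le_one {E F : Type*} [NormedAddCommGroup E]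
    [NormedSpace ℝ E] [FiniteDimensional ℝ E] [NormedAddCommGroup F] [NormedSpace ℝ F]
    {f : E → F} (hf : Continuous f) (h1 : ∀ x, ‖f x‖ ≤ 1) {ε : ℝ} (hε : 0 < ε) :
    ∃ g : E → F, ContDiff ℝ 1 g ∧ ∀ x, ‖g x‖ ≤ 1 ∧ dist (g x) (f x) < ε := by
  obtain ⟨g, hg⟩ := exists_contMDiffMap_forall_mem_convex_of_local_const (n := 1)
    (modelWithCornersSelf ℝ E) (t := fun x => closedBall (0 : F) 1 ∩ ball (f x) ε)
    (fun x => (convex_closedBall _ _).inter (convex_ball _ _)) fun x => ⟨f x, by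
      filter_upwards [hf.continuousAt.eventually (ball_mem_nhds (f x) hε)] with y hy
      exact ⟨by simpa using h1 x, by rwa [mem_ball, dist_comm]⟩⟩
  exact ⟨g, g.contMDiff.contDiff, fun x => ⟨by simpa using (hg x).1, (hg x).2⟩⟩

/-- **Brouwer's fixed point theorem** for the closed unit ball of a Euclidean space. -/
theorem exists_fixedPoint_closedBall {E : Type*} [NormedAddCommGroup E]
    [InnerProductSpace ℝ E] [FiniteDimensional ℝ E]
    {f : closedBall (0 : E) 1 → closedBall (0 : E) 1} (hf : Continuous f) : ∃ x, f x = x := by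
  let P : E → closedBall (0 : E) 1 := fun x => ⟨(max 1 ‖x‖)⁻¹ • x, by
    rw [mem_closedBall_zero_iff, norm_smul, norm_inv, Real.norm_of_nonneg (by positivity),
      inv_mul_le_iff₀ (by positivity), mul_one]
    exact le_max_right _ _⟩
  have hP : Continuous P :=
    (((continuous_const.max continuous_norm).inv₀ fun x => by positivity).smul
      continuous_id).subtype_mk _
  have hPx : ∀ x : closedBall (0 : E) 1, P x = x := fun x => by
    have : ‖(x : E)‖ ≤ 1 := mem_closedBall_zero_iff.1 x.2
    exact Subtype.ext (by simp [P, max_eq_left this])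
  let F : E → E := fun x => f (P x)
  have hF : Continuous F := continuous_subtype_val.comp (hf.comp hP)
  have hF1 : ∀ x, ‖F x‖ ≤ 1 := fun x => mem_closedBall_zero_iff.1 (f (P x)).2
  by_contra! hne
  have hcont : ContinuousOn (fun x => dist (F x) x) (closedBall 0 1) :=
    (hF.dist continuous_id).continuousOn
  -- The least displacement is the tolerance: a smooth approximation this close to `F` has a fixed
  -- point, which `F` would displace by less.
  obtain ⟨z, hz, hmin⟩ := (isCompact_closedBall (0 : E) 1).exists_isMinOn ⟨0, by simp⟩ hcont
  have hε : 0 < dist (F z) z := dist_pos.2 fun h => by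
    refine hne ⟨z, hz⟩ (Subtype.ext ?_)
    rw [← hPx ⟨z, hz⟩]
    simpa only [F, hPx ⟨z, hz⟩] using h
  obtain ⟨g, hg, hg1⟩ := hF.exists_contDiff_dist_lt_of_norm_le_one hF1 hε
  obtain ⟨x, hx⟩ := exists_fixedPoint_of_contDiff_of_norm_le_one hg fun x => (hg1 x).1
  have h1 := hg1 x
  rw [hx, dist_comm] at h1
  exact absurd h1.2 (not_lt.2 (hmin (by simpa using h1.1)))

/-- Brouwer's fixed point theorem for closed discs. -/
theorem IsClosedDisc.exists_fixedPoint {n : ℕ} {D : Set (EuclideanSpace ℝ (Fin n))}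
    (hD : IsClosedDisc D) {f : D → D} (hf : Continuous f) : ∃ x, f x = x := by
  obtain ⟨e⟩ := hD
  obtain ⟨x, hx⟩ := exists_fixedPoint_closedBall (f := e ∘ f ∘ e.symm) (by fun_prop)
  exact ⟨e.symm x, by simpa using congrArg e.symm hx⟩

/-! ### Itineraries and counting -/

/-- The orbit of `x` under the maps `G b`, applied in the order given by the itinerary `W`. -/
def itineraryOrbit {X ι : Type*} (G : ι → X → X) (W : ℕ → ι) (x : X) : ℕ → X
  | 0 => x
  | k + 1 => G (W k) (itineraryOrbit G W x k)

section itineraryOrbit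

variable {X ι : Type*} {G : ι → X → X}

theorem continuous_itineraryOrbit [TopologicalSpace X] (hG : ∀ b, Continuous (G b)) (W : ℕ → ι)
    (k : ℕ) : Continuous fun x => itineraryOrbit G W x k := by
  induction k with
  | zero => exact continuous_id
  | succ k ih => exact (hG (W k)).comp ih

theorem itineraryOrbit_add_of_periodic {W : ℕ → ι} {x : X} {m : ℕ} (hW : Function.Periodic W m)
    (hx : itineraryOrbit G W x m = x) (k : ℕ) :
    itineraryOrbit G W x (k + m) = itineraryOrbit G W x k := by
  induction k with
  | zero => rwa [Nat.zero_add]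
  | succ k ih =>
    rw [Nat.add_right_comm]
    change G (W (k + m)) _ = G (W k) _
    rw [hW k, ih]

/-- If the maps `G b` are injective with disjoint ranges, the endpoint of an orbit determines its
itinerary. -/
theorem eq_of_itineraryOrbit_eq (hG : Function.Injective fun q : ι × X => G q.1 q.2)
    {W W' : ℕ → ι} {x x' : X} {k : ℕ}
    (h : itineraryOrbit G W x k = itineraryOrbit G W' x' k) : ∀ j < k, W j = W' j := by
  induction k with
  | zero => simp
  | succ k ih =>
    have h2 := Prod.ext_iff.1 (@hG (W k, itineraryOrbit G W x k) (W' k, itineraryOrbit G W' x' k) h)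
    intro j hj
    rcases Nat.lt_succ_iff_lt_or_eq.1 hj with hj | rfl
    exacts [ih h2.2 j hj, h2.1]

/-- If every composition of `m` of the maps `G b` has a fixed point, and there are more words of
length `m` than pairs of a position and a point of `S`, then some periodic orbit of length `m`
avoids `S`. -/
theorem exists_periodic_itineraryOrbit_notMem [Fintype ι]
    (hG : Function.Injective fun q : ι × X => G q.1 q.2) {m : ℕ} (hm : 0 < m)
    (hfix : ∀ W : ℕ → ι, ∃ x, itineraryOrbit G W x m = x) (S : Finset X)
    (hcard : m * S.card < Fintype.card ι ^ m) :
    ∃ (W : ℕ → ι) (x : X), itineraryOrbit G W x m = x ∧ ∀ i, itineraryOrbit G W x i ∉ S := by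
  let W : (Fin m → ι) → ℕ → ι := fun w i => w ⟨i % m, Nat.mod_lt i hm⟩
  have hW : ∀ w, Function.Periodic (W w) m := fun w i => by simp [W]
  choose x hx using fun w => hfix (W w)
  by_contra! hbad
  have hmod : ∀ w, ∃ i < m, itineraryOrbit G (W w) (x w) i ∈ S := by
    intro w
    obtain ⟨i, hi⟩ := hbad (W w) (x w) (hx w)
    have hper : Function.Periodic (itineraryOrbit G (W w) (x w)) m :=
      itineraryOrbit_add_of_periodic (hW w) (hx w)
    exact ⟨i % m, Nat.mod_lt i hm, by rwa [hper.map_mod_nat]⟩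
  choose i him hi using hmod
  let φ : (Fin m → ι) → Fin m × S := fun w => (⟨i w, him w⟩, ⟨_, hi w⟩)
  have hφ : Function.Injective φ := by
    intro w w' h
    have h1 : i w = i w' := congrArg (fun q => (q.1 : ℕ)) h
    have h2 : itineraryOrbit G (W w) (x w) (i w) = itineraryOrbit G (W w') (x w') (i w') :=
      congrArg (fun q => (q.2 : X)) h
    -- Waiting one more period puts all `m` letters before the visit to `S`, so the backward reading
    -- recovers the entire word.
    rw [← itineraryOrbit_add_of_periodic (hW w) (hx w), ← h1,
      ← itineraryOrbit_add_of_periodic (hW w') (hx w')] at h2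
    funext j
    have := eq_of_itineraryOrbit_eq hG h2 j (by omega)
    simpa [W, Nat.mod_eq_of_lt j.2] using this
  have := Fintype.card_le_of_injective φ hφ
  simp at this
  omega

end itineraryOrbit

theorem eventually_mul_lt_two_pow (k : ℕ) : ∀ᶠ m : ℕ in Filter.atTop, m * k < 2 ^ m := by
  have h := tendsto_pow_const_div_const_pow_of_one_lt 1 (one_lt_two (α := ℝ))
  filter_upwards [h.eventually (gt_mem_nhds (show (0 : ℝ) < 1 / (k + 1) by positivity))] with m hm
  rw [div_lt_div_iff₀ (by positivity) (by positivity), pow_one, one_mul] at hm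
  have : m * (k + 1) < 2 ^ m := by exact_mod_cast hm
  nlinarith

theorem lemma10 {n : ℕ} (D : Set (EuclideanSpace ℝ (Fin n))) (hD : IsClosedDisc D)
    (g₁ g₂ : D → D) (hg₁ : Continuous g₁) (hg₂ : Continuous g₂)
    (hinj₁ : Function.Injective g₁) (hinj₂ : Function.Injective g₂)
    (hdisj : Disjoint (Set.range g₁) (Set.range g₂))
    (S : Set D) (hS : S.Finite) :
    ∃ M : ℕ, ∀ m ≥ M, ∃ p : Fin (m + 1) → D,
      IsPeriodicOrbit g₁ g₂ m p ∧ ∀ i : Fin (m + 1), p i ∉ S := by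
  let G : Bool → D → D := fun b => if b then g₁ else g₂
  have hGc : ∀ b, Continuous (G b) := by
    rintro (_ | _)
    exacts [hg₂, hg₁]
  have hG : Function.Injective fun q : Bool × D => G q.1 q.2 := by
    rintro ⟨_ | _, x⟩ ⟨_ | _, y⟩ h
    · exact Prod.ext rfl (hinj₂ h)
    · exact absurd h (hdisj.symm.ne_of_mem ⟨x, rfl⟩ ⟨y, rfl⟩)
    · exact absurd h (hdisj.ne_of_mem ⟨x, rfl⟩ ⟨y, rfl⟩)
    · exact Prod.ext rfl (hinj₁ h)
  -- Positivity of `m` is needed because words are extended periodically modulo `m`.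
  obtain ⟨M, hM⟩ := Filter.eventually_atTop.1
    ((eventually_mul_lt_two_pow hS.toFinset.card).and (Filter.eventually_gt_atTop 0))
  refine ⟨M, fun m hm => ?_⟩
  obtain ⟨hcard, hm0⟩ := hM m hm
  obtain ⟨W, x, hx, hmem⟩ := exists_periodic_itineraryOrbit_notMem hG hm0
    (fun W => hD.exists_fixedPoint (continuous_itineraryOrbit hGc W m)) hS.toFinset
    (by simpa using hcard)
  refine ⟨fun i => itineraryOrbit G W x i, ⟨hx, fun i => ?_⟩, fun i => by simpa using hmem i⟩
  change G (W i) _ = _ ∨ G (W i) _ = _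
  cases W i
  exacts [Or.inr rfl, Or.inl rfl]
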